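/- A state is a complex positive semidefinite matrix of trace $1$; it is pure if it equals $|\psi\rangle\langle\psi|$ for a unit vector $\psi$. An $n$-partite state $\rho$ is $k$-UDA ($k$-uniquely determined among all states) if every (pure or mixed) $n$-partite state $\sigma$ on the same systems with $\operatorname{Tr}_{S^c}\sigma=\operatorname{Tr}_{S^c}\rho$ for all sets $S$ of exactly $k$ parties is equal to $\rho$. Two two-qubit states $\eta,\eta'$ are LU-equivalent if $\eta'=(U\otimes V)\,\eta\,(U\otimes V)^\dagger$ for some $2\times 2$ unitaries $U,V$. **Theorem.** Let $\rho=\rho_{A_1}\otimes\rho_{A_2A_3}$ be a three-qubit state, where $\rho_{A_1}$ is a one-qubit state and $\rho_{A_2A_3}$ is a two-qubit state. Then $\rho$ is $2$-UDA if and only if at least one of the following conditions holds: (i) at least one of the one-party marginals $\rho_{A_1},\rho_{A_2},\rho_{A_3}$ of $\rho$ is pure; (ii) $\rho_{A_2A_3}$ is pure; (iii) $\operatorname{rank}\rho_{A_1}=\operatorname{rank}\rho_{A_2A_3}=2$, and $\rho_{A_2A_3}$ is LU-equivalent to a state which in the ordered basis $|00\rangle,|01\rangle,|10\rangle,|11\rangle$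 has the form $$D\oplus 0,\qquad D=\begin{bmatrix} q_1&y&z\\ y^*&q_2&x\\ z^*&x^*&q_3\end{bmatrix},\qquad q_1,q_2,q_3>0,\quad x,y,z\in\mathbb{C}.$$ -/

import Mathlib

open scoped ComplexOrder Kronecker

/-- A (mixed or pure) quantum state with orthonormal basis labelled by `n`: a density matrix. -/
def IsState {n : Type*} [Fintype n] (ρ : Matrix n n ℂ) : Prop :=
  ρ.PosSemidef ∧ ρ.trace = 1

/-- `ρ` is a pure state, i.e. `ρ = |ψ⟩⟨ψ|` for a unit vector `ψ`. -/
def IsPure {n : Type*} [Fintype n] (ρ : Matrix n n ℂ) : Prop :=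
  ∃ ψ : n → ℂ, star ψ ⬝ᵥ ψ = 1 ∧ ρ = Matrix.vecMulVec ψ (star ψ)

/-- The marginal of `ρ` on the subset `S` of the parties `ι`, obtained by tracing out the parties
outside `S`. Party `i` has the computational basis `κ i`, and the product basis of all parties is
labelled by `(i : ι) → κ i`. -/
def marginal {ι : Type*} [Fintype ι] [DecidableEq ι] {κ : ι → Type*} [∀ i, Fintype (κ i)]
    (S : Finset ι) (ρ : Matrix ((i : ι) → κ i) ((i : ι) → κ i) ℂ) :
    Matrix ((i : {i // i ∈ S}) → κ i) ((i : {i // i ∈ S}) → κ i) ℂ :=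
  fun x y => ∑ z : (i : {i // i ∉ S}) → κ i,
    ρ ((Equiv.piEquivPiSubtypeProd (fun i => i ∈ S) κ).symm (x, z))
      ((Equiv.piEquivPiSubtypeProd (fun i => i ∈ S) κ).symm (y, z))

/-- `σ` is `k`-compatible with `ρ`: they have the same `k`-partite marginals. -/
def IsCompatible {ι : Type*} [Fintype ι] [DecidableEq ι] {κ : ι → Type*} [∀ i, Fintype (κ i)]
    (k : ℕ) (σ ρ : Matrix ((i : ι) → κ i) ((i : ι) → κ i) ℂ) : Prop :=
  ∀ S : Finset ι, S.card = k → marginal S σ = marginal S ρ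

/-- The state `ρ` is `k`-uniquely determined among all states (`k`-UDA). -/
def IsUDA {ι : Type*} [Fintype ι] [DecidableEq ι] {κ : ι → Type*} [∀ i, Fintype (κ i)]
    (k : ℕ) (ρ : Matrix ((i : ι) → κ i) ((i : ι) → κ i) ℂ) : Prop :=
  IsState ρ ∧ ∀ σ : Matrix ((i : ι) → κ i) ((i : ι) → κ i) ℂ,
    IsState σ → IsCompatible k σ ρ → σ = ρ

/-- The three-qubit operator `α ⊗ β`, with `α` acting on party `0` and `β` on parties `1, 2`. -/
def tensor₁₂ (α : Matrix (Fin 2) (Fin 2) ℂ) (β : Matrix (Fin 2 × Fin 2) (Fin 2 × Fin 2) ℂ) :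
    Matrix (Fin 3 → Fin 2) (Fin 3 → Fin 2) ℂ :=
  (α ⊗ₖ β).submatrix (fun x => (x 0, (x 1, x 2))) (fun x => (x 0, (x 1, x 2)))

/-- Bipartite operators `ρ` and `σ` are equivalent up to local unitaries. -/
def LUEquiv {m n : Type*} [Fintype m] [DecidableEq m] [Fintype n] [DecidableEq n]
    (ρ σ : Matrix (m × n) (m × n) ℂ) : Prop :=
  ∃ U ∈ Matrix.unitaryGroup m ℂ, ∃ V ∈ Matrix.unitaryGroup n ℂ,
    σ = (U ⊗ₖ V) * ρ * (U ⊗ₖ V).conjTranspose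

/-- The two-qubit operator with matrix `D ⊕ 0` in the ordered basis `00, 01, 10, 11`. -/
def directSumZero (D : Matrix (Fin 3) (Fin 3) ℂ) :
    Matrix (Fin 2 × Fin 2) (Fin 2 × Fin 2) ℂ :=
  let e : Fin 3 ⊕ Fin 1 ≃ Fin 2 × Fin 2 :=
    (finSumFinEquiv : Fin 3 ⊕ Fin 1 ≃ Fin 4).trans
      (finProdFinEquiv : Fin 2 × Fin 2 ≃ Fin 4).symm
  Matrix.reindex e e (Matrix.fromBlocks D 0 0 (0 : Matrix (Fin 1) (Fin 1) ℂ))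

/-! Write ρ = α ⊗ β and split operators into blocks along A₁. If σ has the same two-party marginals
as ρ, every block of σ - ρ has both partial traces zero (from A₁A₃ and A₁A₂), and it annihilates ker
β, since σ is positive with A₂A₃ marginal β. So the question is whether a nonzero Y on A₂A₃ has zero
partial traces and kills ker β together with its adjoint. If none exists, ρ is determined
(`isUDA_tensor₁₂_of_forall_eq_zero`). If a Hermitian one exists and α is invertible, α ⊗ β + ε Z ⊗ Y
with Z = diag(1, -1) and small ε > 0 is a different compatible state (`not_isUDA_tensor₁₂`). A pure
marginal, on one party or on A₂A₃, settles the matter at once: every compatible state factors into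
marginals that are already fixed.

It remains to find Y when nothing is pure. For rank β ≥ 3 the kernel is at most a line, and killing
one vector imposes 8 real equations on the 9-dimensional real space of Hermitian operators with zero
partial traces. For rank 2 the kernel is a plane, so it meets the quadric of product vectors; rotate
such a vector to |11⟩. Mixedness of the marginals makes the |01⟩ and |10⟩ diagonal entries positive.
If the |00⟩ entry is also positive, this is form (iii), where entrywise comparison forces Y = 0; if
it is zero, the kernel is spanned by |00⟩ and |11⟩, and Y = |01⟩⟨10| + |10⟩⟨01| works. -/

namespace Matrix

/-! ### Positivity-preserving perturbations. -/

section Perturbation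

variable {n : Type*} [Fintype n] [DecidableEq n]

/-- A sufficiently small Hermitian perturbation of the identity is positive semidefinite. -/
lemma IsHermitian.exists_posSemidef_one_add_smul {W : Matrix n n ℂ} (hW : W.IsHermitian) :
    ∃ ε : ℝ, 0 < ε ∧ (1 + (ε : ℂ) • W).PosSemidef := by
  set w := hW.eigenvalues with hw
  have hs : 0 ≤ ∑ i, |w i| := Finset.sum_nonneg fun i _ => abs_nonneg _
  -- This ε gives ε|wᵢ| ≤ 1 for every eigenvalue; the added 1 keeps the denominator positive when W
  -- = 0.
  refine ⟨1 / (1 + ∑ i, |w i|), by positivity, ?_⟩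
  set ε : ℝ := 1 / (1 + ∑ i, |w i|) with hε
  have hε0 : 0 < ε := by positivity
  have hd : (diagonal fun i => (1 : ℂ) + (ε : ℂ) * (w i : ℂ)).PosSemidef := by
    refine PosSemidef.diagonal fun i => ?_
    have h1 : |w i| ≤ ∑ i, |w i| :=
      Finset.single_le_sum (f := fun i => |w i|) (fun i _ => abs_nonneg _) (Finset.mem_univ i)
    have h2 : ε * (1 + ∑ i, |w i|) = 1 := by rw [hε]; field_simp
    have h3 : 0 ≤ 1 + ε * w i := by
      nlinarith [neg_abs_le (w i), mul_le_mul_of_nonneg_left h1 hε0.le,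
        mul_le_mul_of_nonneg_left (neg_abs_le (w i)) hε0.le]
    have : ((0 : ℝ) : ℂ) ≤ ((1 + ε * w i : ℝ) : ℂ) := by exact_mod_cast h3
    simpa using this
  set V : Matrix n n ℂ := (hW.eigenvectorUnitary : Matrix n n ℂ) with hV
  have hVV : V * star V = 1 := Unitary.coe_mul_star_self _
  have hspec : W = V * diagonal (fun i => (w i : ℂ)) * star V := by
    have := hW.spectral_theorem
    rwa [Unitary.conjStarAlgAut_apply] at this
  have hsum : 1 + (ε : ℂ) • W
      = V * (diagonal fun i => (1 : ℂ) + (ε : ℂ) * (w i : ℂ)) * Vᴴ := by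
    have : (diagonal fun i => (1 : ℂ) + (ε : ℂ) * (w i : ℂ))
        = 1 + (ε : ℂ) • diagonal (fun i => (w i : ℂ)) := by
      rw [← diagonal_one, ← diagonal_smul, diagonal_add]
      rfl
    rw [this, mul_add, add_mul, mul_one, ← star_eq_conjTranspose, hVV, mul_smul_comm,
      smul_mul_assoc, ← hspec]
  rw [hsum]
  exact hd.mul_mul_conjTranspose_same V

/-- If the kernel of a Hermitian `X` contains that of a positive semidefinite `M`, then some
perturbation of `M` in the direction of `X` is still positive semidefinite. -/
lemma PosSemidef.exists_posSemidef_add_smul {M X : Matrix n n ℂ} (hM : M.PosSemidef)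
    (hX : X.IsHermitian) (hker : ∀ v, M *ᵥ v = 0 → X *ᵥ v = 0) :
    ∃ ε : ℝ, 0 < ε ∧ (M + (ε : ℂ) • X).PosSemidef := by
  set l := hM.1.eigenvalues with hl
  have hl0 : ∀ i, 0 ≤ l i := hM.eigenvalues_nonneg
  set V : Matrix n n ℂ := (hM.1.eigenvectorUnitary : Matrix n n ℂ) with hV
  have hVV : V * star V = 1 := Unitary.coe_mul_star_self _
  have hVV' : star V * V = 1 := Unitary.coe_star_mul_self _
  have hspec : M = V * diagonal (fun i => (l i : ℂ)) * star V := by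
    have := hM.1.spectral_theorem
    rwa [Unitary.conjStarAlgAut_apply] at this
  set Z := star V * X * V with hZ
  have hZh : Z.IsHermitian := by
    have := isHermitian_conjTranspose_mul_mul V hX
    rwa [← star_eq_conjTranspose] at this
  have hcol : ∀ i j, l j = 0 → Z i j = 0 := by
    intro i j hj
    have h1 : M *ᵥ (V *ᵥ Pi.single j 1) = 0 := by
      have : (diagonal fun i => (l i : ℂ)) *ᵥ Pi.single j 1 = 0 := by
        ext k
        rw [mulVec_diagonal]
        by_cases hk : k = j
        · subst hk; simp [hj]
        · simp [hk]
      rw [hspec, mulVec_mulVec, mul_assoc, hVV', mul_one, ← mulVec_mulVec, this, mulVec_zero]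
    have h2 : Z *ᵥ Pi.single j 1 = 0 := by
      rw [hZ, ← mulVec_mulVec, ← mulVec_mulVec, hker _ h1, mulVec_zero]
    have := congrFun h2 i
    simpa using this
  have hrow : ∀ i j, l i = 0 → Z i j = 0 := by
    intro i j hi
    rw [← hZh.apply, hcol j i hi, star_zero]
  set s : n → ℂ := fun i => (Real.sqrt (l i) : ℂ) with hs
  have hss : ∀ i, s i * s i = l i := by
    intro i
    simp only [hs]
    exact_mod_cast Real.mul_self_sqrt (hl0 i)
  have hs0 : ∀ i, s i = 0 → l i = 0 := by
    intro i hi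
    have := hss i
    rw [hi] at this
    simpa using this.symm
  -- With the convention 0⁻¹ = 0 this uses the pseudo-inverse of √M. Nothing is lost, because Z
  -- vanishes on the rows and columns of zero eigenvalues, so M + εX becomes a congruence of 1 + εW.
  set W : Matrix n n ℂ := diagonal (fun i => (s i)⁻¹) * Z * diagonal (fun i => (s i)⁻¹) with hWdef
  have hWapp : ∀ i j, W i j = (s i)⁻¹ * Z i j * (s j)⁻¹ := by
    intro i j
    rw [hWdef, mul_diagonal, diagonal_mul]
  have hWh : W.IsHermitian := by
    refine IsHermitian.ext fun i j => ?_
    rw [hWapp, hWapp, star_mul', star_mul', hZh.apply]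
    simp only [hs, star_inv₀, Complex.star_def, Complex.conj_ofReal]
    ring
  have hZW : Z = diagonal s * W * diagonal s := by
    ext i j
    rw [mul_diagonal, diagonal_mul, hWapp]
    by_cases hi : s i = 0
    · rw [hrow i j (hs0 i hi)]; simp
    by_cases hj : s j = 0
    · rw [hcol i j (hs0 j hj)]; simp
    field_simp
  obtain ⟨ε, hε, hpos⟩ := hWh.exists_posSemidef_one_add_smul
  refine ⟨ε, hε, ?_⟩
  have hdiag : (diagonal s)ᴴ = diagonal s := by
    rw [diagonal_conjTranspose]
    congr 1
    ext i
    simp [hs]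
  have hD : diagonal (fun i => (l i : ℂ)) = diagonal s * diagonal s := by
    rw [diagonal_mul_diagonal]
    congr 1
    ext i
    exact (hss i).symm
  have hXZ : X = V * Z * star V := by
    rw [hZ]
    calc X = (V * star V) * X * (V * star V) := by rw [hVV, one_mul, mul_one]
      _ = _ := by simp only [mul_assoc]
  have key : M + (ε : ℂ) • X
      = (V * diagonal s) * (1 + (ε : ℂ) • W) * (V * diagonal s)ᴴ := by
    rw [conjTranspose_mul, hdiag, ← star_eq_conjTranspose, hspec, hD, hXZ, hZW]
    simp only [mul_add, add_mul, mul_one, mul_smul_comm, smul_mul_assoc, mul_assoc]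
  rw [key]
  exact hpos.mul_mul_conjTranspose_same _

end Perturbation

/-! ### Partial traces, product unitaries and kernels of marginals. -/

section PartialTrace

/-- The partial trace over the first tensor factor. -/
def traceLeft {m n : Type*} [Fintype m] (M : Matrix (m × n) (m × n) ℂ) : Matrix n n ℂ :=
  of fun c d => ∑ a, M (a, c) (a, d)

/-- The partial trace over the second tensor factor. -/
def traceRight {m n : Type*} [Fintype n] (M : Matrix (m × n) (m × n) ℂ) : Matrix m m ℂ :=
  of fun a b => ∑ c, M (a, c) (b, c)

lemma traceLeft_apply {m n : Type*} [Fintype m] (M : Matrix (m × n) (m × n) ℂ) (c d : n) :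
    traceLeft M c d = ∑ a, M (a, c) (a, d) := rfl

lemma traceRight_apply {m n : Type*} [Fintype n] (M : Matrix (m × n) (m × n) ℂ) (a b : m) :
    traceRight M a b = ∑ c, M (a, c) (b, c) := rfl

lemma trace_traceLeft {m n : Type*} [Fintype m] [Fintype n]
    (M : Matrix (m × n) (m × n) ℂ) : (traceLeft M).trace = M.trace := by
  simp only [trace, diag_apply, traceLeft_apply, Fintype.sum_prod_type]
  exact Finset.sum_comm

lemma trace_traceRight {m n : Type*} [Fintype m] [Fintype n]
    (M : Matrix (m × n) (m × n) ℂ) : (traceRight M).trace = M.trace := by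
  simp only [trace, diag_apply, traceRight_apply, Fintype.sum_prod_type]

end PartialTrace

end Matrix

namespace Matrix

section PartialTrace

lemma PosSemidef.traceLeft {m n : Type*} [Fintype m] [Fintype n]
    {M : Matrix (m × n) (m × n) ℂ} (hM : M.PosSemidef) : (traceLeft M).PosSemidef := by
  have : Matrix.traceLeft M = ∑ a, M.submatrix (Prod.mk a) (Prod.mk a) := by
    ext c d
    simp [traceLeft_apply, sum_apply]
  rw [this]
  exact posSemidef_sum _ fun a _ => hM.submatrix _

lemma traceRight_eq_traceLeft_swap {m n : Type*} [Fintype n] (M : Matrix (m × n) (m × n) ℂ) :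
    traceRight M = traceLeft (M.submatrix Prod.swap Prod.swap) := rfl

lemma PosSemidef.traceRight {m n : Type*} [Fintype m] [Fintype n]
    {M : Matrix (m × n) (m × n) ℂ} (hM : M.PosSemidef) : (traceRight M).PosSemidef := by
  rw [traceRight_eq_traceLeft_swap]
  exact (hM.submatrix _).traceLeft

lemma trace_mul_one_kronecker {m n : Type*} [Fintype m] [Fintype n] [DecidableEq m]
    (M : Matrix (m × n) (m × n) ℂ) (B : Matrix n n ℂ) :
    (M * ((1 : Matrix m m ℂ) ⊗ₖ B)).trace = (traceLeft M * B).trace := by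
  simp only [trace, diag_apply, mul_apply, Fintype.sum_prod_type, traceLeft_apply,
    kronecker_apply, one_apply, ite_mul, one_mul, zero_mul, mul_ite, mul_zero,
    Finset.sum_mul]
  rw [Finset.sum_comm]
  refine Finset.sum_congr rfl fun c _ => ?_
  rw [Finset.sum_comm (γ := n)]
  refine Finset.sum_congr rfl fun a _ => ?_
  rw [Finset.sum_comm]
  simp

/-- The partial trace is dual to B ↦ 1 ⊗ B. In this form, invariance under product unitaries is just
cyclicity of the trace. -/
lemma traceLeft_eq_zero_iff {m n : Type*} [Fintype m] [Fintype n] [DecidableEq m]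
    [DecidableEq n] {M : Matrix (m × n) (m × n) ℂ} :
    traceLeft M = 0 ↔ ∀ B : Matrix n n ℂ, (M * ((1 : Matrix m m ℂ) ⊗ₖ B)).trace = 0 := by
  refine ⟨fun h B => by rw [trace_mul_one_kronecker, h, zero_mul, trace_zero], fun h => ?_⟩
  ext c d
  have := h (single d c 1)
  rw [trace_mul_one_kronecker, trace_mul_single] at this
  simpa using this

/-- Vanishing of the partial trace is preserved by product unitaries. -/
lemma traceLeft_kronecker_conj_eq_zero {m n : Type*} [Fintype m] [Fintype n] [DecidableEq m]
    [DecidableEq n] {M : Matrix (m × n) (m × n) ℂ} (h : traceLeft M = 0) {U : Matrix m m ℂ}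
    (hU : U ∈ unitaryGroup m ℂ) (V : Matrix n n ℂ) :
    traceLeft ((U ⊗ₖ V) * M * (U ⊗ₖ V)ᴴ) = 0 := by
  rw [traceLeft_eq_zero_iff] at h ⊢
  intro B
  have hU' : Uᴴ * U = 1 := mem_unitaryGroup_iff'.mp hU
  rw [mul_assoc, mul_assoc, trace_mul_comm, mul_assoc, conjTranspose_kronecker,
    ← mul_kronecker_mul, ← mul_kronecker_mul, mul_one, hU']
  exact h _

lemma traceRight_kronecker_conj_eq_zero {m n : Type*} [Fintype m] [Fintype n] [DecidableEq m]
    [DecidableEq n] {M : Matrix (m × n) (m × n) ℂ} (h : traceRight M = 0) (U : Matrix m m ℂ)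
    {V : Matrix n n ℂ} (hV : V ∈ unitaryGroup n ℂ) :
    traceRight ((U ⊗ₖ V) * M * (U ⊗ₖ V)ᴴ) = 0 := by
  rw [traceRight_eq_traceLeft_swap] at h ⊢
  have hsw : ((U ⊗ₖ V) * M * (U ⊗ₖ V)ᴴ).submatrix Prod.swap Prod.swap
      = (V ⊗ₖ U) * M.submatrix Prod.swap Prod.swap * (V ⊗ₖ U)ᴴ := by
    have hk : (U ⊗ₖ V).submatrix Prod.swap Prod.swap = V ⊗ₖ U := by
      ext ⟨a, b⟩ ⟨c, d⟩
      simp [mul_comm]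
    rw [← hk, conjTranspose_submatrix]
    have := submatrix_mul_equiv ((U ⊗ₖ V) * M) ((U ⊗ₖ V)ᴴ) Prod.swap (Equiv.prodComm n m) Prod.swap
    have h2 := submatrix_mul_equiv (U ⊗ₖ V) M Prod.swap (Equiv.prodComm n m) Prod.swap
    simp only [Equiv.coe_prodComm] at this h2
    rw [← this, ← h2]
  rw [hsw]
  exact traceLeft_kronecker_conj_eq_zero h hV U

/-- A kernel vector of a marginal of a positive semidefinite matrix extends to kernel vectors
of the matrix itself. -/
lemma PosSemidef.sum_mul_eq_zero_of_traceRight_mulVec {m n : Type*} [Fintype m] [Fintype n]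
    {M : Matrix (m × n) (m × n) ℂ} (hM : M.PosSemidef) {v : m → ℂ}
    (hv : Matrix.traceRight M *ᵥ v = 0) (a : m) (c d : n) : ∑ b, M (a, c) (b, d) * v b = 0 := by
  classical
  -- The marginal is a sum of positive diagonal blocks, so its vanishing quadratic form at v
  -- vanishes on each block; hence M kills v ⊗ e_d.
  set N : n → Matrix m m ℂ := fun d => M.submatrix (fun a => (a, d)) (fun a => (a, d)) with hN
  have hNp : ∀ d, (N d).PosSemidef := fun d => hM.submatrix _
  have hsum : Matrix.traceRight M = ∑ d, N d := by
    ext a b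
    simp [traceRight_apply, sum_apply, hN]
  have h0 : ∑ d, star v ⬝ᵥ (N d *ᵥ v) = 0 := by
    rw [← dotProduct_sum, ← sum_mulVec, ← hsum, hv, dotProduct_zero]
  have h1 : star v ⬝ᵥ (N d *ᵥ v) = 0 :=
    (Finset.sum_eq_zero_iff_of_nonneg fun d _ => (hNp d).dotProduct_mulVec_nonneg v).mp h0 d
      (Finset.mem_univ d)
  set w : m × n → ℂ := fun p => if p.2 = d then v p.1 else 0 with hw
  have hMw : ∀ p, (M *ᵥ w) p = ∑ b, M p (b, d) * v b := by
    intro p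
    simp [mulVec, dotProduct, Fintype.sum_prod_type, hw]
  have h2 : star w ⬝ᵥ (M *ᵥ w) = 0 := by
    rw [← h1]
    simp only [dotProduct, Fintype.sum_prod_type, hMw, Pi.star_apply]
    refine Finset.sum_congr rfl fun a _ => ?_
    rw [Finset.sum_eq_single d]
    · simp [hw, mulVec, dotProduct, hN]
    · intro c _ hc
      simp [hw, hc]
    · simp
  have h3 := (hM.dotProduct_mulVec_zero_iff w).mp h2
  rw [← hMw, h3]
  rfl

lemma PosSemidef.sum_mul_eq_zero_of_traceLeft_mulVec {m n : Type*} [Fintype m] [Fintype n]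
    {M : Matrix (m × n) (m × n) ℂ} (hM : M.PosSemidef) {v : n → ℂ}
    (hv : Matrix.traceLeft M *ᵥ v = 0) (a b : m) (c : n) : ∑ d, M (a, c) (b, d) * v d = 0 :=
  (hM.submatrix Prod.swap).sum_mul_eq_zero_of_traceRight_mulVec (M := M.submatrix _ _) hv c a b

end PartialTrace

end Matrix

/-! ### Pure states and pure marginals. -/

open Matrix

/-- A state whose marginal on the first factor is pure is the product of its marginals. -/
lemma IsPure.eq_mul_traceLeft {m n : Type*} [Fintype m] [Fintype n]
    {M : Matrix (m × n) (m × n) ℂ} (hM : M.PosSemidef) (hp : IsPure (traceRight M))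
    (a b : m) (c d : n) : M (a, c) (b, d) = traceRight M a b * traceLeft M c d := by
  classical
  obtain ⟨ψ, hψ, hM1⟩ := hp
  have hψ' : ∑ a, star (ψ a) * ψ a = 1 := hψ
  have hcol : ∀ a b c d, M (a, c) (b, d) = star (ψ b) * ∑ b', M (a, c) (b', d) * ψ b' := by
    intro a b c d
    -- This is the projection of the basis vector e_b onto the orthogonal complement of ψ, the
    -- kernel of |ψ⟩⟨ψ|.
    have hk : traceRight M *ᵥ (Pi.single b 1 - star (ψ b) • ψ) = 0 := by
      rw [hM1, vecMulVec_mulVec, dotProduct_sub, dotProduct_smul, hψ]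
      simp
    have := hM.sum_mul_eq_zero_of_traceRight_mulVec hk a c d
    simp only [Pi.sub_apply, Pi.smul_apply, mul_sub, Finset.sum_sub_distrib, smul_eq_mul] at this
    rw [sub_eq_zero] at this
    simp only [Pi.single_apply, mul_ite, mul_one, mul_zero, Finset.sum_ite_eq', Finset.mem_univ,
      if_true] at this
    rw [this, Finset.mul_sum]
    exact Finset.sum_congr rfl fun _ _ => by ring
  have hprod : ∀ c d, ∃ K, ∀ a b, M (a, c) (b, d) = ψ a * star (ψ b) * K := by
    intro c d
    refine ⟨∑ b', star (∑ a', M (b', d) (a', c) * ψ a') * ψ b', fun a b => ?_⟩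
    rw [hcol, mul_comm (ψ a), mul_assoc, Finset.mul_sum (a := ψ a)]
    congr 1
    refine Finset.sum_congr rfl fun b' _ => ?_
    rw [← hM.1.apply, hcol, star_mul', star_star, mul_assoc]
  obtain ⟨K, hK⟩ := hprod c d
  have htr : traceLeft M c d = K := by
    simp only [traceLeft_apply, hK]
    rw [← Finset.sum_mul]
    simp only [mul_comm (ψ _)]
    rw [hψ', one_mul]
  rw [htr, hK, hM1, vecMulVec_apply]
  rfl

/-- A state of rank one is pure. -/
lemma IsState.isPure_of_rank_le_one {n : Type*} [Fintype n] {M : Matrix n n ℂ} (hM : IsState M)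
    (hr : M.rank ≤ 1) : IsPure M := by
  classical
  obtain ⟨hp, ht⟩ := hM
  rw [Matrix.rank, finrank_le_one_iff] at hr
  obtain ⟨⟨v, _⟩, hv⟩ := hr
  have hcol : ∀ j, ∃ c : ℂ, ∀ i, M i j = c * v i := by
    intro j
    obtain ⟨c, hc⟩ := hv ⟨M *ᵥ Pi.single j 1, ⟨_, rfl⟩⟩
    refine ⟨c, fun i => ?_⟩
    have := congrFun (congrArg Subtype.val hc) i
    simpa using this.symm
  choose w hw using hcol
  -- All columns are proportional, so column k divided by √(M k k) serves as ψ.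
  obtain ⟨k, hk⟩ : ∃ k, M k k ≠ 0 := by
    by_contra! h
    simp [trace, h] at ht
  have hkn : 0 ≤ M k k := hp.diag_nonneg
  set q := (M k k).re with hq
  have hqk : M k k = (q : ℂ) := (Complex.eq_re_of_ofReal_le hkn)
  have hq0 : 0 ≤ q := by
    rw [hqk] at hkn
    exact_mod_cast hkn
  set s : ℂ := (Real.sqrt q : ℂ) with hs
  have hss : s * s = M k k := by
    rw [hqk, hs]
    exact_mod_cast Real.mul_self_sqrt hq0
  have hs0 : s ≠ 0 := by
    intro h
    rw [h, mul_zero] at hss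
    exact hk hss.symm
  have hstar : star s = s := by simp [hs]
  have hent : M = vecMulVec (fun i => M i k / s) (star fun i => M i k / s) := by
    ext i j
    have h2 : M i j * M k k = M i k * M k j := by
      simp only [hw]
      ring
    simp only [vecMulVec_apply, Pi.star_apply, star_div₀, hstar, hp.1.apply]
    rw [div_mul_div_comm, hss, eq_div_iff hk, h2]
  refine ⟨fun i => M i k / s, ?_, hent⟩
  rw [hent, trace_vecMulVec, dotProduct_comm] at ht
  exact ht

/-! ### Three-qubit marginals as partial traces of blocks. -/

/-- Labelling of the product basis of three qubits by triples. -/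
def threeQubitEquiv : (Fin 3 → Fin 2) ≃ Fin 2 × Fin 2 × Fin 2 where
  toFun x := (x 0, x 1, x 2)
  invFun p := ![p.1, p.2.1, p.2.2]
  left_inv x := by
    ext i
    fin_cases i <;> rfl
  right_inv _ := rfl

lemma tensor₁₂_eq_submatrix (α : Matrix (Fin 2) (Fin 2) ℂ)
    (β : Matrix (Fin 2 × Fin 2) (Fin 2 × Fin 2) ℂ) :
    tensor₁₂ α β = (α ⊗ₖ β).submatrix threeQubitEquiv threeQubitEquiv := rfl

lemma isState_submatrix_equiv {m n : Type*} [Fintype m] [Fintype n] (e : m ≃ n)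
    {M : Matrix n n ℂ} : IsState (M.submatrix e e) ↔ IsState M := by
  rw [IsState, IsState, posSemidef_submatrix_equiv]
  have : (M.submatrix e e).trace = M.trace := by
    simp only [trace, diag_apply, submatrix_apply]
    exact Equiv.sum_comp e fun i => M i i
  rw [this]

lemma IsPure.submatrix_equiv {m n : Type*} [Fintype m] [Fintype n] {M : Matrix n n ℂ}
    (h : IsPure M) (e : m ≃ n) : IsPure (M.submatrix e e) := by
  obtain ⟨ψ, hψ, rfl⟩ := h
  refine ⟨ψ ∘ e, ?_, rfl⟩
  rw [← hψ]
  exact Equiv.sum_comp e fun i => star ψ i * ψ i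

lemma isPure_submatrix_equiv {m n : Type*} [Fintype m] [Fintype n] (e : m ≃ n)
    {M : Matrix n n ℂ} : IsPure (M.submatrix e e) ↔ IsPure M := by
  refine ⟨fun h => ?_, fun h => h.submatrix_equiv e⟩
  simpa using h.submatrix_equiv e.symm

lemma marginal_restrict_of_unique {ι κ : Type*} [Fintype ι] [DecidableEq ι] [Fintype κ]
    {S : Finset ι} {j : ι} (hj : ∀ i, i ∉ S ↔ i = j) (σ : Matrix (ι → κ) (ι → κ) ℂ)
    (x y : ι → κ) :
    marginal S σ (fun i => x i) (fun i => y i)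
      = ∑ b, σ (Function.update x j b) (Function.update y j b) := by
  let _ : Unique {i // i ∉ S} :=
    { default := ⟨j, (hj j).mpr rfl⟩
      uniq := fun i => Subtype.ext ((hj i).mp i.2) }
  refine Fintype.sum_equiv (Equiv.funUnique {i // i ∉ S} κ) _ _ fun z => ?_
  have key : ∀ w : ι → κ, (Equiv.piEquivPiSubtypeProd (fun i => i ∈ S) fun _ => κ).symm
      (fun i => w i, z) = Function.update w j (Equiv.funUnique {i // i ∉ S} κ z) := by
    intro w
    ext i
    by_cases hi : i ∈ S
    · have : i ≠ j := fun h => (hj i).mpr h hi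
      simp [Equiv.piEquivPiSubtypeProd, hi, this]
    · obtain rfl := (hj i).mp hi
      simp [Equiv.piEquivPiSubtypeProd, hi]
      rfl
  rw [key, key]

lemma marginal_eq_marginal_iff {ι κ : Type*} [Fintype ι] [DecidableEq ι] [Fintype κ]
    {S : Finset ι} {j : ι} (hj : ∀ i, i ∉ S ↔ i = j) [Nonempty κ]
    (σ τ : Matrix (ι → κ) (ι → κ) ℂ) :
    marginal S σ = marginal S τ ↔ ∀ x y : ι → κ,
      ∑ b, σ (Function.update x j b) (Function.update y j b)
        = ∑ b, τ (Function.update x j b) (Function.update y j b) := by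
  constructor
  · intro h x y
    rw [← marginal_restrict_of_unique hj, ← marginal_restrict_of_unique hj, h]
  · intro h
    obtain ⟨k⟩ := ‹Nonempty κ›
    ext x y
    have hx : ∀ x : {i // i ∈ S} → κ, ∃ w : ι → κ, x = fun i : {i // i ∈ S} => w i := fun x =>
      ⟨fun i => if hi : i ∈ S then x ⟨i, hi⟩ else k, by ext i; simp⟩
    obtain ⟨x, rfl⟩ := hx x
    obtain ⟨y, rfl⟩ := hx y
    rw [marginal_restrict_of_unique hj, marginal_restrict_of_unique hj, h]

/-- The block of a bipartite operator at the basis labels `a`, `b` of the first factor. -/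
def Matrix.block {m n : Type*} (M : Matrix (m × n) (m × n) ℂ) (a b : m) : Matrix n n ℂ :=
  M.submatrix (Prod.mk a) (Prod.mk b)

/-- Two-party sets are complements of single parties: tracing out party `0` is `traceLeft`, while
tracing out `1` or `2` acts inside each block along party `0`. -/
lemma isCompatible_two_submatrix_iff (σ τ : Matrix (Fin 2 × Fin 2 × Fin 2) (Fin 2 × Fin 2 × Fin 2) ℂ) :
    IsCompatible 2 (σ.submatrix threeQubitEquiv threeQubitEquiv)
        (τ.submatrix threeQubitEquiv threeQubitEquiv) ↔
      traceLeft σ = traceLeft τ ∧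
        ∀ a b, traceLeft (σ.block a b) = traceLeft (τ.block a b) ∧
          traceRight (σ.block a b) = traceRight (τ.block a b) := by
  have hS : ∀ S : Finset (Fin 3), S.card = 2 ↔ ∃ j, ∀ i, i ∉ S ↔ i = j := by decide
  have hex : ∀ j : Fin 3, ∃ S : Finset (Fin 3), ∀ i, i ∉ S ↔ i = j := by decide
  have h1 : IsCompatible 2 (σ.submatrix threeQubitEquiv threeQubitEquiv)
        (τ.submatrix threeQubitEquiv threeQubitEquiv) ↔ ∀ j, ∀ x y : Fin 3 → Fin 2,
      ∑ b, σ (threeQubitEquiv (Function.update x j b)) (threeQubitEquiv (Function.update y j b))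
        = ∑ b, τ (threeQubitEquiv (Function.update x j b))
            (threeQubitEquiv (Function.update y j b)) := by
    constructor
    · intro h j
      obtain ⟨S, hj⟩ := hex j
      exact (marginal_eq_marginal_iff hj _ _).mp (h S ((hS S).mpr ⟨j, hj⟩))
    · intro h S hc
      obtain ⟨j, hj⟩ := (hS S).mp hc
      exact (marginal_eq_marginal_iff hj _ _).mpr (h j)
  rw [h1, Fin.forall_fin_succ, Fin.forall_fin_succ, Fin.forall_fin_one]
  constructor
  · rintro ⟨h0, h1, h2⟩
    refine ⟨?_, fun a b => ⟨?_, ?_⟩⟩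
    · ext ⟨a, b⟩ ⟨c, d⟩
      exact h0 ![0, a, b] ![0, c, d]
    · ext c d
      exact h1 ![a, 0, c] ![b, 0, d]
    · ext c d
      exact h2 ![a, c, 0] ![b, d, 0]
  · rintro ⟨h0, h12⟩
    refine ⟨fun x y => ?_, fun x y => ?_, fun x y => ?_⟩
    · exact congrFun₂ h0 (x 1, x 2) (y 1, y 2)
    · exact congrFun₂ (h12 (x 0) (y 0)).1 (x 2) (y 2)
    · exact congrFun₂ (h12 (x 0) (y 0)).2 (x 1) (y 1)

lemma isUDA_two_submatrix_iff (τ : Matrix (Fin 2 × Fin 2 × Fin 2) (Fin 2 × Fin 2 × Fin 2) ℂ) :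
    IsUDA 2 (τ.submatrix threeQubitEquiv threeQubitEquiv) ↔ IsState τ ∧
      ∀ σ, IsState σ → traceLeft σ = traceLeft τ →
        (∀ a b, traceLeft (σ.block a b) = traceLeft (τ.block a b) ∧
          traceRight (σ.block a b) = traceRight (τ.block a b)) → σ = τ := by
  rw [IsUDA, isState_submatrix_equiv]
  refine and_congr_right fun _ => ⟨fun h σ hσ h0 h12 => ?_, fun h σ hσ hc => ?_⟩
  · have := h (σ.submatrix threeQubitEquiv threeQubitEquiv)
      ((isState_submatrix_equiv _).mpr hσ) ((isCompatible_two_submatrix_iff σ τ).mpr ⟨h0, h12⟩)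
    simpa using congrArg (fun M => M.submatrix threeQubitEquiv.symm threeQubitEquiv.symm) this
  · obtain ⟨σ, rfl⟩ : ∃ σ', σ = σ'.submatrix threeQubitEquiv threeQubitEquiv :=
      ⟨σ.submatrix threeQubitEquiv.symm threeQubitEquiv.symm, by simp⟩
    obtain ⟨h0, h12⟩ := (isCompatible_two_submatrix_iff σ τ).mp hc
    rw [h σ ((isState_submatrix_equiv _).mp hσ) h0 h12]

/-- The one-party marginal of three qubits at party `i`, the other parties being `j` and `k`. -/
lemma marginal_singleton_apply {ι κ : Type*} [Fintype ι] [DecidableEq ι] [Fintype κ]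
    {i j k : ι} (hjk : j ≠ k) (h : ∀ l, l ∉ ({i} : Finset ι) ↔ l = j ∨ l = k)
    (σ : Matrix (ι → κ) (ι → κ) ℂ) (x y : {l // l ∈ ({i} : Finset ι)} → κ) :
    marginal {i} σ x y = ∑ p : κ × κ,
      σ (fun l => if l = i then x ⟨i, by simp⟩ else if l = j then p.1 else p.2)
        (fun l => if l = i then y ⟨i, by simp⟩ else if l = j then p.1 else p.2) := by
  let e : ({l // l ∉ ({i} : Finset ι)} → κ) ≃ κ × κ :=
    { toFun := fun z => (z ⟨j, (h j).mpr (Or.inl rfl)⟩, z ⟨k, (h k).mpr (Or.inr rfl)⟩)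
      invFun := fun p l => if l.1 = j then p.1 else p.2
      left_inv := fun z => by
        ext ⟨l, hl⟩
        rcases (h l).mp hl with rfl | rfl
        · simp
        · simp [hjk.symm]
      right_inv := fun p => by simp [hjk.symm] }
  refine Fintype.sum_equiv e _ _ fun z => ?_
  have key : ∀ w : {l // l ∈ ({i} : Finset ι)} → κ,
      (Equiv.piEquivPiSubtypeProd (fun l => l ∈ ({i} : Finset ι)) fun _ => κ).symm (w, z)
        = fun l => if l = i then w ⟨i, by simp⟩ else if l = j then (e z).1 else (e z).2 := by
    intro w
    ext l
    by_cases hl : l ∈ ({i} : Finset ι)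
    · obtain rfl := Finset.mem_singleton.mp hl
      simp [Equiv.piEquivPiSubtypeProd]
    · have hli : l ≠ i := fun h => hl (Finset.mem_singleton.mpr h)
      rcases (h l).mp hl with rfl | rfl
      · simp [Equiv.piEquivPiSubtypeProd, hli, e]
      · simp [Equiv.piEquivPiSubtypeProd, hli, e, hjk.symm]
  rw [key, key]

lemma isPure_marginal_singleton_iff {ι κ : Type*} [Fintype ι] [DecidableEq ι] [Fintype κ]
    {i j k : ι} (hjk : j ≠ k) (h : ∀ l, l ∉ ({i} : Finset ι) ↔ l = j ∨ l = k)
    (σ : Matrix (ι → κ) (ι → κ) ℂ) :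
    IsPure (marginal {i} σ) ↔ IsPure (of fun a b : κ => ∑ p : κ × κ,
      σ (fun l => if l = i then a else if l = j then p.1 else p.2)
        (fun l => if l = i then b else if l = j then p.1 else p.2)) := by
  let _ : Unique {l // l ∈ ({i} : Finset ι)} :=
    { default := ⟨i, by simp⟩
      uniq := fun l => Subtype.ext (Finset.mem_singleton.mp l.2) }
  rw [← isPure_submatrix_equiv (Equiv.funUnique {l // l ∈ ({i} : Finset ι)} κ)]
  have : marginal {i} σ = (of fun a b : κ => ∑ p : κ × κ,
      σ (fun l => if l = i then a else if l = j then p.1 else p.2)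
        (fun l => if l = i then b else if l = j then p.1 else p.2)).submatrix
      (Equiv.funUnique {l // l ∈ ({i} : Finset ι)} κ)
      (Equiv.funUnique {l // l ∈ ({i} : Finset ι)} κ) := by
    ext x y
    rw [marginal_singleton_apply hjk h]
    rfl
  rw [this]

lemma exists_isPure_marginal_tensor₁₂_iff {α : Matrix (Fin 2) (Fin 2) ℂ}
    {β : Matrix (Fin 2 × Fin 2) (Fin 2 × Fin 2) ℂ} (hα : α.trace = 1) (hβ : β.trace = 1) :
    (∃ i : Fin 3, IsPure (marginal {i} (tensor₁₂ α β))) ↔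
      IsPure α ∨ IsPure (traceRight β) ∨ IsPure (traceLeft β) := by
  rw [Fin.exists_fin_succ, Fin.exists_fin_succ, Fin.exists_fin_one]
  refine or_congr ?_ (or_congr ?_ ?_)
  · rw [isPure_marginal_singleton_iff (i := (0 : Fin 3)) (j := 1) (k := 2) (by decide) (by decide)]
    convert Iff.rfl using 2
    ext a b
    have : ∑ p : Fin 2 × Fin 2, α a b * β p p = α a b := by
      rw [← Finset.mul_sum]
      exact (congrArg _ hβ).trans (mul_one _)
    exact this.symm
  · refine (isPure_marginal_singleton_iff (i := (1 : Fin 3)) (j := 0) (k := 2) (by decide)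
      (by decide) _).trans ?_
    convert Iff.rfl using 2
    ext a b
    have : ∑ p : Fin 2 × Fin 2, α p.1 p.1 * β (a, p.2) (b, p.2) = traceRight β a b := by
      exact (Fintype.sum_prod_type _).trans ((Finset.sum_mul_sum _ _ (fun x => α x x)
        fun y => β (a, y) (b, y)).symm.trans ((congrArg (· * _) hα).trans (one_mul _)))
    exact this.symm
  · refine (isPure_marginal_singleton_iff (i := (2 : Fin 3)) (j := 0) (k := 1) (by decide)
      (by decide) _).trans ?_
    convert Iff.rfl using 2
    ext a b
    have : ∑ p : Fin 2 × Fin 2, α p.1 p.1 * β (p.2, a) (p.2, b) = traceLeft β a b := by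
      exact (Fintype.sum_prod_type _).trans ((Finset.sum_mul_sum _ _ (fun x => α x x)
        fun y => β (y, a) (y, b)).symm.trans ((congrArg (· * _) hα).trans (one_mul _)))
    exact this.symm

/-! ### Sufficient conditions for being determined. -/

/-- Two states with the same marginals, one of which is pure, are equal. -/
lemma eq_of_traceRight_eq_of_traceLeft_eq {m n : Type*} [Fintype m] [Fintype n]
    {M N : Matrix (m × n) (m × n) ℂ} (hM : M.PosSemidef) (hN : N.PosSemidef)
    (hp : IsPure (traceRight N)) (h₁ : traceRight M = traceRight N)
    (h₂ : traceLeft M = traceLeft N) : M = N := by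
  ext ⟨a, c⟩ ⟨b, d⟩
  rw [IsPure.eq_mul_traceLeft hM (h₁ ▸ hp), IsPure.eq_mul_traceLeft hN hp, h₁, h₂]

lemma trace_block_eq_traceRight {m n : Type*} [Fintype n] (M : Matrix (m × n) (m × n) ℂ)
    (a b : m) : (M.block a b).trace = traceRight M a b := rfl

section Tensor

variable {m n : Type*} (α : Matrix m m ℂ) (β : Matrix n n ℂ)

lemma traceLeft_kronecker [Fintype m] : traceLeft (α ⊗ₖ β) = α.trace • β := by
  ext c d
  simp [traceLeft_apply, trace, Finset.sum_mul]

lemma traceRight_kronecker [Fintype n] : traceRight (α ⊗ₖ β) = β.trace • α := by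
  ext c d
  simp [traceRight_apply, trace, mul_comm, Finset.mul_sum]

lemma block_kronecker (a b : m) : (α ⊗ₖ β).block a b = α a b • β := rfl

end Tensor

lemma IsState.kronecker {m n : Type*} [Fintype m] [Fintype n] {α : Matrix m m ℂ}
    {β : Matrix n n ℂ} (hα : IsState α) (hβ : IsState β) : IsState (α ⊗ₖ β) :=
  ⟨hα.1.kronecker hβ.1, by rw [trace_kronecker, hα.2, hβ.2, one_mul]⟩

section UDA

variable {α : Matrix (Fin 2) (Fin 2) ℂ} {β : Matrix (Fin 2 × Fin 2) (Fin 2 × Fin 2) ℂ}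

lemma isUDA_tensor₁₂_iff (hα : IsState α) (hβ : IsState β) :
    IsUDA 2 (tensor₁₂ α β) ↔
      ∀ σ, IsState σ → traceLeft σ = traceLeft (α ⊗ₖ β) →
        (∀ a b, traceLeft (σ.block a b) = traceLeft ((α ⊗ₖ β).block a b) ∧
          traceRight (σ.block a b) = traceRight ((α ⊗ₖ β).block a b)) → σ = α ⊗ₖ β := by
  rw [tensor₁₂_eq_submatrix, isUDA_two_submatrix_iff, and_iff_right (hα.kronecker hβ)]

lemma isUDA_tensor₁₂_of_isPure_left (hα : IsState α) (hβ : IsState β) (hp : IsPure α) :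
    IsUDA 2 (tensor₁₂ α β) := by
  refine (isUDA_tensor₁₂_iff hα hβ).mpr fun σ hσ h0 h12 => ?_
  refine eq_of_traceRight_eq_of_traceLeft_eq hσ.1 (hα.kronecker hβ).1 ?_ ?_ h0
  · rwa [traceRight_kronecker, hβ.2, one_smul]
  · ext a b
    rw [← trace_block_eq_traceRight, ← trace_block_eq_traceRight, ← trace_traceLeft, (h12 a b).1,
      trace_traceLeft]

lemma isUDA_tensor₁₂_of_isPure_right (hα : IsState α) (hβ : IsState β) (hp : IsPure β) :
    IsUDA 2 (tensor₁₂ α β) := by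
  refine (isUDA_tensor₁₂_iff hα hβ).mpr fun σ hσ h0 h12 => ?_
  have h : σ.submatrix Prod.swap Prod.swap = (α ⊗ₖ β).submatrix Prod.swap Prod.swap := by
    refine eq_of_traceRight_eq_of_traceLeft_eq (hσ.1.submatrix _)
      ((hα.kronecker hβ).1.submatrix _) ?_ h0 ?_
    · change IsPure (traceLeft (α ⊗ₖ β))
      rwa [traceLeft_kronecker, hα.2, one_smul]
    · change traceRight σ = traceRight (α ⊗ₖ β)
      ext a b
      rw [← trace_block_eq_traceRight, ← trace_block_eq_traceRight, ← trace_traceLeft,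
        (h12 a b).1, trace_traceLeft]
  ext ⟨a, p⟩ ⟨b, q⟩
  exact congrFun₂ h (p, a) (q, b)

/-- Move A₂ to the front by `f`: a pure A₂ splits off from any compatible state, and the remaining
factor is the prescribed A₁A₃ marginal. -/
lemma isUDA_tensor₁₂_of_isPure_traceRight (hα : IsState α) (hβ : IsState β)
    (hp : IsPure (traceRight β)) : IsUDA 2 (tensor₁₂ α β) := by
  refine (isUDA_tensor₁₂_iff hα hβ).mpr fun σ hσ h0 h12 => ?_
  let f : Fin 2 × Fin 2 × Fin 2 → Fin 2 × Fin 2 × Fin 2 := fun p => (p.2.1, p.1, p.2.2)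
  have hf : ∀ M : Matrix (Fin 2 × Fin 2 × Fin 2) (Fin 2 × Fin 2 × Fin 2) ℂ,
      traceRight (M.submatrix f f) = traceRight (traceLeft M) := by
    intro M
    ext a b
    simp only [traceRight_apply, traceLeft_apply, Fintype.sum_prod_type]
    exact Finset.sum_comm
  have h : σ.submatrix f f = (α ⊗ₖ β).submatrix f f := by
    refine eq_of_traceRight_eq_of_traceLeft_eq (hσ.1.submatrix _)
      ((hα.kronecker hβ).1.submatrix _) ?_ ?_ ?_
    · rwa [hf, traceLeft_kronecker, hα.2, one_smul]
    · rw [hf, hf, h0]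
    · ext ⟨a, c⟩ ⟨b, d⟩
      exact congrFun₂ (h12 a b).1 c d
  ext ⟨a, p⟩ ⟨b, q⟩
  exact congrFun₂ h (p.1, a, p.2) (q.1, b, q.2)

lemma isUDA_tensor₁₂_of_isPure_traceLeft (hα : IsState α) (hβ : IsState β)
    (hp : IsPure (traceLeft β)) : IsUDA 2 (tensor₁₂ α β) := by
  refine (isUDA_tensor₁₂_iff hα hβ).mpr fun σ hσ h0 h12 => ?_
  let f : Fin 2 × Fin 2 × Fin 2 → Fin 2 × Fin 2 × Fin 2 := fun p => (p.2.1, p.2.2, p.1)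
  have hf : ∀ M : Matrix (Fin 2 × Fin 2 × Fin 2) (Fin 2 × Fin 2 × Fin 2) ℂ,
      traceRight (M.submatrix f f) = traceLeft (traceLeft M) := by
    intro M
    ext a b
    simp only [traceRight_apply, traceLeft_apply, Fintype.sum_prod_type]
    exact Finset.sum_comm
  have h : σ.submatrix f f = (α ⊗ₖ β).submatrix f f := by
    refine eq_of_traceRight_eq_of_traceLeft_eq (hσ.1.submatrix _)
      ((hα.kronecker hβ).1.submatrix _) ?_ ?_ ?_
    · rwa [hf, traceLeft_kronecker, hα.2, one_smul]
    · rw [hf, hf, h0]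
    · ext ⟨a, c⟩ ⟨b, d⟩
      exact congrFun₂ (h12 a b).2 c d
  ext ⟨a, p⟩ ⟨b, q⟩
  exact congrFun₂ h (p.2, a, p.1) (q.2, b, q.1)

/-- If no nonzero operator with vanishing partial traces annihilates, together with its adjoint,
the kernel of `β`, then `α ⊗ β` is determined by its two-party marginals. -/
lemma isUDA_tensor₁₂_of_forall_eq_zero (hα : IsState α) (hβ : IsState β)
    (h : ∀ Y : Matrix (Fin 2 × Fin 2) (Fin 2 × Fin 2) ℂ, traceLeft Y = 0 → traceRight Y = 0 →
      (∀ v, β *ᵥ v = 0 → Y *ᵥ v = 0 ∧ Yᴴ *ᵥ v = 0) → Y = 0) :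
    IsUDA 2 (tensor₁₂ α β) := by
  refine (isUDA_tensor₁₂_iff hα hβ).mpr fun σ hσ h0 h12 => ?_
  have hb : ∀ a b, σ.block a b - (α ⊗ₖ β).block a b = 0 := by
    have hv : ∀ v, β *ᵥ v = 0 → ∀ a b, (σ.block a b - (α ⊗ₖ β).block a b) *ᵥ v = 0 := by
      intro v hv a b
      have h1 : (σ.block a b) *ᵥ v = 0 := by
        ext p
        refine hσ.1.sum_mul_eq_zero_of_traceLeft_mulVec ?_ a b p
        rw [h0, traceLeft_kronecker, hα.2, one_smul, hv]
      rw [sub_mulVec, h1, block_kronecker, smul_mulVec, hv, smul_zero, sub_zero]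
    -- The adjoint of a block is the transposed block, so the adjoint condition follows from the
    -- same kernel statement.
    have hH : ∀ {M : Matrix (Fin 2 × Fin 2 × Fin 2) (Fin 2 × Fin 2 × Fin 2) ℂ},
        M.IsHermitian → ∀ a b, (M.block a b)ᴴ = M.block b a := by
      intro M hM a b
      ext p q
      exact hM.apply _ _
    intro a b
    refine h _ ?_ ?_ fun v hv' => ⟨hv v hv' a b, ?_⟩
    · have := (h12 a b).1
      ext c d
      simpa [traceLeft_apply, sub_eq_zero] using congrFun₂ this c d
    · have := (h12 a b).2
      ext c d
      simpa [traceRight_apply, sub_eq_zero] using congrFun₂ this c d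
    · rw [conjTranspose_sub, hH hσ.1.1, hH (hα.kronecker hβ).1.1]
      exact hv v hv' b a
  ext ⟨a, p⟩ ⟨b, q⟩
  exact sub_eq_zero.mp (congrFun₂ (hb a b) p q)

end UDA

/-! ### Sufficiency of the rank-two normal form. -/

lemma directSumZero_eq_of (D : Matrix (Fin 3) (Fin 3) ℂ) :
    directSumZero D = of fun p q => (!![!![D 0 0, D 0 1; D 1 0, D 1 1], !![D 0 2, 0; D 1 2, 0];
      !![D 2 0, D 2 1; 0, 0], !![D 2 2, 0; 0, 0]] p.1 q.1) p.2 q.2 := by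
  ext ⟨a, b⟩ ⟨c, d⟩
  fin_cases a <;> fin_cases b <;> fin_cases c <;> fin_cases d <;> rfl

lemma Matrix.kronecker_mem_unitaryGroup' {m n : Type*} [Fintype m] [DecidableEq m] [Fintype n]
    [DecidableEq n] {U : Matrix m m ℂ} {V : Matrix n n ℂ} (hU : U ∈ unitaryGroup m ℂ)
    (hV : V ∈ unitaryGroup n ℂ) :
    (U ⊗ₖ V)ᴴ * (U ⊗ₖ V) = 1 ∧ (U ⊗ₖ V) * (U ⊗ₖ V)ᴴ = 1 := by
  have h := kronecker_mem_unitary hU hV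
  exact ⟨mem_unitaryGroup_iff'.mp h, mem_unitaryGroup_iff.mp h⟩

lemma mulVec_conj_eq_zero_iff {n : Type*} [Fintype n] [DecidableEq n] {W β : Matrix n n ℂ}
    (hW : Wᴴ * W = 1) (w : n → ℂ) : (W * β * Wᴴ) *ᵥ w = 0 ↔ β *ᵥ (Wᴴ *ᵥ w) = 0 := by
  constructor
  · intro h
    have := congrArg (Wᴴ *ᵥ ·) h
    simpa [mulVec_mulVec, ← mul_assoc, hW] using this
  · intro h
    rw [← mulVec_mulVec, ← mulVec_mulVec, h, mulVec_zero]

/-- An operator with vanishing partial traces which, together with its adjoint, annihilates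
`|11⟩` and a vector with a component along `|01⟩` or `|10⟩` is zero. -/
lemma eq_zero_of_traceLeft_of_traceRight_of_mulVec
    {Y : Matrix (Fin 2 × Fin 2) (Fin 2 × Fin 2) ℂ} (hl : traceLeft Y = 0) (hr : traceRight Y = 0)
    (h1 : Y *ᵥ Pi.single (1, 1) 1 = 0) (h2 : Yᴴ *ᵥ Pi.single (1, 1) 1 = 0)
    {w : Fin 2 × Fin 2 → ℂ} (h3 : Y *ᵥ w = 0) (h4 : Yᴴ *ᵥ w = 0)
    (hw : w (0, 1) ≠ 0 ∨ w (1, 0) ≠ 0) : Y = 0 := by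
  have hl' : ∀ c d, Y (0, c) (0, d) + Y (1, c) (1, d) = 0 := fun c d => by
    simpa [traceLeft_apply] using congrFun₂ hl c d
  have hr' : ∀ c d, Y (c, 0) (d, 0) + Y (c, 1) (d, 1) = 0 := fun c d => by
    simpa [traceRight_apply] using congrFun₂ hr c d
  have hc : ∀ p, Y p (1, 1) = 0 := fun p => by simpa using congrFun h1 p
  have hrow : ∀ p, Y (1, 1) p = 0 := fun p => by simpa using congrFun h2 p
  have e01 : Y (0, 1) (0, 1) = 0 := by simpa [hc] using hl' 1 1
  have e10 : Y (1, 0) (1, 0) = 0 := by simpa [hc] using hr' 1 1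
  have e00 : Y (0, 0) (0, 0) = 0 := by simpa [e10] using hl' 0 0
  have f1 : Y (0, 0) (1, 0) = 0 := by simpa [hc] using hr' 0 1
  have f2 : Y (1, 0) (0, 0) = 0 := by simpa [hrow] using hr' 1 0
  have f3 : Y (0, 0) (0, 1) = 0 := by simpa [hc] using hl' 0 1
  have f4 : Y (0, 1) (0, 0) = 0 := by simpa [hrow] using hl' 1 0
  -- Only the entries |01⟩⟨10| and |10⟩⟨01| of Y are still undetermined; Y and its adjoint acting on
  -- w give two equations for each.
  have g1 : Y (0, 1) (1, 0) * w (1, 0) = 0 := by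
    simpa [mulVec, dotProduct, Fintype.sum_prod_type, hc, e01, f4] using congrFun h3 (0, 1)
  have g2 : Y (1, 0) (0, 1) * w (0, 1) = 0 := by
    simpa [mulVec, dotProduct, Fintype.sum_prod_type, hc, e10, f2] using congrFun h3 (1, 0)
  have g3 : star (Y (1, 0) (0, 1)) * w (1, 0) = 0 := by
    simpa [mulVec, dotProduct, Fintype.sum_prod_type, hrow, e01, f3] using congrFun h4 (0, 1)
  have g4 : star (Y (0, 1) (1, 0)) * w (0, 1) = 0 := by
    simpa [mulVec, dotProduct, Fintype.sum_prod_type, hrow, e10, f1] using congrFun h4 (1, 0)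
  have k1 : Y (0, 1) (1, 0) = 0 := by
    rcases hw with h | h
    · simpa [h] using g4
    · simpa [h] using g1
  have k2 : Y (1, 0) (0, 1) = 0 := by
    rcases hw with h | h
    · simpa [h] using g2
    · simpa [h] using g3
  ext ⟨a, b⟩ ⟨c, d⟩
  fin_cases a <;> fin_cases b <;> fin_cases c <;> fin_cases d <;>
    simp only [Fin.zero_eta, Fin.mk_one, Fin.isValue, hc, hrow, e00, e01, e10, f1, f2, f3, f4, k1,
      k2, Matrix.zero_apply]

lemma finrank_ker_mulVecLin {n : Type*} [Fintype n] (β : Matrix n n ℂ) :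
    β.rank + Module.finrank ℂ (LinearMap.ker β.mulVecLin) = Fintype.card n := by
  rw [Matrix.rank, LinearMap.finrank_range_add_finrank_ker, Module.finrank_fintype_fun_eq_card]

section UDA

variable {α : Matrix (Fin 2) (Fin 2) ℂ} {β : Matrix (Fin 2 × Fin 2) (Fin 2 × Fin 2) ℂ}

/-- After the rotation |11⟩ lies in the kernel, and rank two supplies an independent second kernel
vector. Without |01⟩ and |10⟩ components, its |00⟩ component would vanish too, as `D 0 0 ≠ 0`,
making it a multiple of |11⟩. -/
lemma isUDA_tensor₁₂_of_lUEquiv_directSumZero (hα : IsState α) (hβ : IsState β)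
    (hr : β.rank = 2) {D : Matrix (Fin 3) (Fin 3) ℂ} (hD : D 0 0 ≠ 0)
    (hLU : LUEquiv β (directSumZero D)) : IsUDA 2 (tensor₁₂ α β) := by
  obtain ⟨U, hU, V, hV, hUV⟩ := hLU
  obtain ⟨hW, hW'⟩ := kronecker_mem_unitaryGroup' hU hV
  refine isUDA_tensor₁₂_of_forall_eq_zero hα hβ fun Y hl hr' hY => ?_
  have hl2 := traceLeft_kronecker_conj_eq_zero hl hU V
  have hr2 := traceRight_kronecker_conj_eq_zero hr' U hV
  set W := U ⊗ₖ V with hWdef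
  have h11 : β *ᵥ (Wᴴ *ᵥ Pi.single (1, 1) 1) = 0 := by
    rw [← mulVec_conj_eq_zero_iff hW, ← hUV, directSumZero_eq_of]
    ext ⟨a, b⟩
    fin_cases a <;> fin_cases b <;> simp
  have hYW : ∀ w, β *ᵥ (Wᴴ *ᵥ w) = 0 → (W * Y * Wᴴ) *ᵥ w = 0 ∧ (W * Y * Wᴴ)ᴴ *ᵥ w = 0 := by
    intro w hw
    refine ⟨(mulVec_conj_eq_zero_iff hW w).mpr (hY _ hw).1, ?_⟩
    have : (W * Y * Wᴴ)ᴴ = W * Yᴴ * Wᴴ := by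
      simp [conjTranspose_mul, mul_assoc]
    rw [this]
    exact (mulVec_conj_eq_zero_iff hW w).mpr (hY _ hw).2
  obtain ⟨v, hv, hvs⟩ : ∃ v ∈ LinearMap.ker β.mulVecLin,
      v ∉ Submodule.span ℂ {Wᴴ *ᵥ Pi.single (1, 1) 1} := by
    by_contra! h
    have h1 := Submodule.finrank_mono h
    have h2 := finrank_span_le_card (R := ℂ) {Wᴴ *ᵥ (Pi.single (1, 1) 1 : Fin 2 × Fin 2 → ℂ)}
    have h3 := finrank_ker_mulVecLin β
    simp [hr] at h2 h3
    omega
  have hv0 : β *ᵥ v = 0 := hv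
  have hWv : Wᴴ *ᵥ (W *ᵥ v) = v := by rw [mulVec_mulVec, hW, one_mulVec]
  have hw : (W *ᵥ v) (0, 1) ≠ 0 ∨ (W *ᵥ v) (1, 0) ≠ 0 := by
    by_contra! h
    obtain ⟨h01, h10⟩ := h
    have h00 : (W *ᵥ v) (0, 0) = 0 := by
      have h1 : directSumZero D *ᵥ (W *ᵥ v) = 0 := by
        rw [hUV, mulVec_conj_eq_zero_iff hW, hWv, hv0]
      generalize W *ᵥ v = w at h1 h01 h10
      rw [directSumZero_eq_of] at h1
      have := congrFun h1 (0, 0)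
      simpa [mulVec, dotProduct, Fintype.sum_prod_type, h01, h10, hD] using this
    refine hvs (Submodule.mem_span_singleton.mpr ⟨(W *ᵥ v) (1, 1), ?_⟩)
    have : W *ᵥ v = (W *ᵥ v) (1, 1) • Pi.single (1, 1) 1 := by
      ext ⟨a, b⟩
      fin_cases a <;> fin_cases b <;> simp [h00, h01, h10]
    rw [← mulVec_smul, ← this, hWv]
  have h0 : W * Y * Wᴴ = 0 :=
    eq_zero_of_traceLeft_of_traceRight_of_mulVec hl2 hr2 (hYW _ h11).1 (hYW _ h11).2
      (hYW (W *ᵥ v) (by rw [hWv, hv0])).1 (hYW (W *ᵥ v) (by rw [hWv, hv0])).2 hw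
  calc Y = (Wᴴ * W) * Y * (Wᴴ * W) := by rw [hW, one_mul, mul_one]
    _ = Wᴴ * (W * Y * Wᴴ) * W := by simp only [mul_assoc]
    _ = 0 := by rw [h0, mul_zero, zero_mul]

/-! ### Necessity: competitors, and the geometry of the kernel. -/

/-- If `α` is invertible and some nonzero Hermitian operator with vanishing partial traces
annihilates the kernel of `β`, then `α ⊗ β` is not determined by its two-party marginals. -/
lemma not_isUDA_tensor₁₂ (hα : IsState α) (hβ : IsState β) (hdet : α.det ≠ 0)
    {Y : Matrix (Fin 2 × Fin 2) (Fin 2 × Fin 2) ℂ} (hY : Y.IsHermitian) (hY0 : Y ≠ 0)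
    (hl : traceLeft Y = 0) (hr : traceRight Y = 0) (hker : ∀ v, β *ᵥ v = 0 → Y *ᵥ v = 0) :
    ¬ IsUDA 2 (tensor₁₂ α β) := by
  set Z : Matrix (Fin 2) (Fin 2) ℂ := !![1, 0; 0, -1] with hZ
  have hZh : Z.IsHermitian := by
    ext i j
    fin_cases i <;> fin_cases j <;> simp [hZ]
  have hX : (Z ⊗ₖ Y).IsHermitian := by
    rw [IsHermitian, conjTranspose_kronecker, hZh.eq, hY.eq]
  have hkr : ∀ (A : Matrix (Fin 2) (Fin 2) ℂ) (B : Matrix (Fin 2 × Fin 2) (Fin 2 × Fin 2) ℂ) v a p,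
      ((A ⊗ₖ B) *ᵥ v) (a, p) = ∑ b, A a b * (B *ᵥ fun q => v (b, q)) p := by
    intro A B v a p
    simp only [mulVec, dotProduct, Fintype.sum_prod_type (f := fun x : Fin 2 × Fin 2 × Fin 2 => _),
      kronecker_apply, mul_assoc, Finset.mul_sum]
  -- Invertibility of α puts every slice of a kernel vector in ker β, where Y vanishes.
  have hXker : ∀ v, (α ⊗ₖ β) *ᵥ v = 0 → (Z ⊗ₖ Y) *ᵥ v = 0 := by
    intro v hv
    have h1 : ∀ b, β *ᵥ (fun q => v (b, q)) = 0 := by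
      intro b
      ext p
      have : α *ᵥ (fun b => (β *ᵥ fun q => v (b, q)) p) = 0 := by
        ext a
        have := congrFun hv (a, p)
        rw [hkr] at this
        exact this
      exact congrFun (eq_zero_of_mulVec_eq_zero hdet this) b
    ext ⟨a, p⟩
    rw [hkr]
    simp [hker _ (h1 _)]
  obtain ⟨ε, hε, hpos⟩ := (hα.kronecker hβ).1.exists_posSemidef_add_smul hX hXker
  have hZt : Z.trace = 0 := by simp [hZ, trace]
  intro huda
  have hXl : traceLeft (Z ⊗ₖ Y) = 0 := by rw [traceLeft_kronecker, hZt, zero_smul]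
  have hadd : ∀ c d, traceLeft (α ⊗ₖ β + (ε : ℂ) • (Z ⊗ₖ Y)) c d
      = traceLeft (α ⊗ₖ β) c d + ε * traceLeft (Z ⊗ₖ Y) c d := by
    intro c d
    simp only [traceLeft_apply, Matrix.add_apply, Matrix.smul_apply, smul_eq_mul, Finset.sum_add_distrib,
      Finset.mul_sum]
  have h := (isUDA_tensor₁₂_iff hα hβ).mp huda (α ⊗ₖ β + (ε : ℂ) • (Z ⊗ₖ Y)) ⟨hpos, ?_⟩ ?_ ?_
  · have h0 : (ε : ℂ) • (Z ⊗ₖ Y) = 0 := by simpa using h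
    refine hY0 ?_
    ext p q
    have := congrFun₂ h0 (0, p) (0, q)
    simpa [hZ, hε.ne'] using this
  · rw [trace_add, trace_smul, trace_kronecker Z, hZt, (hα.kronecker hβ).2]
    simp
  · ext c d
    rw [hadd, hXl]
    simp
  · intro a b
    constructor
    · ext c d
      have : ∑ x, Y (x, c) (x, d) = 0 := congrFun₂ hl c d
      simp only [traceLeft_apply, Matrix.block, submatrix_apply, Matrix.add_apply,
        Matrix.smul_apply, smul_eq_mul,
        kronecker_apply, Finset.sum_add_distrib, ← Finset.mul_sum, this]
      simp
    · ext c d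
      have : ∑ x, Y (c, x) (d, x) = 0 := congrFun₂ hr c d
      simp only [traceRight_apply, Matrix.block, submatrix_apply, Matrix.add_apply,
        Matrix.smul_apply, smul_eq_mul, kronecker_apply, Finset.sum_add_distrib,
        ← Finset.mul_sum, this]
      simp

end UDA

/-- Every vector of a two-qubit space is annihilated by some nonzero Hermitian operator with
vanishing partial traces. -/
lemma exists_isHermitian_mulVec_eq_zero (v : Fin 2 × Fin 2 → ℂ) :
    ∃ Y : Matrix (Fin 2 × Fin 2) (Fin 2 × Fin 2) ℂ, Y.IsHermitian ∧ Y ≠ 0 ∧ traceLeft Y = 0 ∧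
      traceRight Y = 0 ∧ Y *ᵥ v = 0 := by
  -- Zero partial traces mean traceless blocks with opposite diagonal blocks. This leaves 1 + 4·2 =
  -- 9 real parameters, against the 8 real equations T t v = 0.
  let T : ℝ × ℂ × ℂ × ℂ × ℂ → Matrix (Fin 2 × Fin 2) (Fin 2 × Fin 2) ℂ :=
    fun t => of fun p q =>
      (!![!![(t.1 : ℂ), t.2.1; star t.2.1, -t.1], !![t.2.2.1, t.2.2.2.1; t.2.2.2.2, -t.2.2.1];
          !![star t.2.2.1, star t.2.2.2.2; star t.2.2.2.1, -star t.2.2.1],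
          !![-(t.1 : ℂ), -t.2.1; -star t.2.1, t.1]] p.1 q.1) p.2 q.2
  have hadd : ∀ s t, T (s + t) = T s + T t := by
    intro s t
    ext ⟨a, b⟩ ⟨c, d⟩
    fin_cases a <;> fin_cases b <;> fin_cases c <;> fin_cases d <;> simp [T] <;> ring
  have hsmul : ∀ (r : ℝ) t, T (r • t) = r • T t := by
    intro s t
    ext ⟨a, b⟩ ⟨c, d⟩
    fin_cases a <;> fin_cases b <;> fin_cases c <;> fin_cases d <;> simp [T]
  let f : (ℝ × ℂ × ℂ × ℂ × ℂ) →ₗ[ℝ] (Fin 2 × Fin 2 → ℂ) :=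
    { toFun := fun t => T t *ᵥ v
      map_add' := fun s t => by rw [hadd, add_mulVec]
      map_smul' := fun r t => by rw [hsmul, smul_mulVec]; rfl }
  have hker : LinearMap.ker f ≠ ⊥ := by
    refine f.ker_ne_bot_of_finrank_lt ?_
    simp [Module.finrank_prod, Module.finrank_pi_fintype, Complex.finrank_real_complex]
  obtain ⟨t, ht, ht0⟩ := Submodule.exists_mem_ne_zero_of_ne_bot hker
  refine ⟨T t, ?_, fun h => ht0 ?_, ?_, ?_, ht⟩
  · ext ⟨a, b⟩ ⟨c, d⟩
    fin_cases a <;> fin_cases b <;> fin_cases c <;> fin_cases d <;> simp [T]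
  · obtain ⟨r, u, a, b, c⟩ := t
    have h1 := congrFun₂ h (0, 0) (0, 0)
    have h2 := congrFun₂ h (0, 0) (0, 1)
    have h3 := congrFun₂ h (0, 0) (1, 0)
    have h4 := congrFun₂ h (0, 0) (1, 1)
    have h5 := congrFun₂ h (0, 1) (1, 0)
    simp [T] at h1 h2 h3 h4 h5
    simp [h1, h2, h3, h4, h5]
  · ext a b
    fin_cases a <;> fin_cases b <;> simp [T, traceLeft_apply]
  · ext a b
    fin_cases a <;> fin_cases b <;> simp [T, traceRight_apply]

/-- A two-dimensional space of two-qubit vectors contains a nonzero product vector. -/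
lemma exists_mem_product_of_one_lt_finrank (K : Submodule ℂ (Fin 2 × Fin 2 → ℂ))
    (hK : 1 < Module.finrank ℂ K) :
    ∃ a b : Fin 2 → ℂ, a ≠ 0 ∧ b ≠ 0 ∧ (fun p => a p.1 * b p.2) ∈ K := by
  obtain ⟨v, hvK, hv0, hdet⟩ :
      ∃ v ∈ K, v ≠ 0 ∧ v (0, 0) * v (1, 1) = v (0, 1) * v (1, 0) := by
    have : Nontrivial K := Module.nontrivial_of_finrank_pos (R := ℂ) (by omega)
    obtain ⟨x, hx⟩ := exists_ne (0 : K)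
    obtain ⟨y, hy⟩ := exists_linearIndependent_pair_of_one_lt_finrank hK hx
    rw [LinearIndependent.pair_iff] at hy
    by_cases h : y.1 (0, 0) * y.1 (1, 1) = y.1 (0, 1) * y.1 (1, 0)
    · refine ⟨y, y.2, fun h0 => ?_, h⟩
      have := hy 0 1 (by rw [zero_smul, one_smul, zero_add]; exact Subtype.ext h0)
      simp at this
    -- Product vectors are those of zero determinant, and det(x + t y) is quadratic in t with
    -- leading coefficient det y ≠ 0, so it has a complex root.
    · obtain ⟨s, hs⟩ := IsAlgClosed.exists_eq_mul_self (discrim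
        (y.1 (0, 0) * y.1 (1, 1) - y.1 (0, 1) * y.1 (1, 0))
        (x.1 (0, 0) * y.1 (1, 1) + y.1 (0, 0) * x.1 (1, 1) - x.1 (0, 1) * y.1 (1, 0)
          - y.1 (0, 1) * x.1 (1, 0))
        (x.1 (0, 0) * x.1 (1, 1) - x.1 (0, 1) * x.1 (1, 0)))
      obtain ⟨t, ht⟩ := exists_quadratic_eq_zero (sub_ne_zero.mpr h) ⟨s, hs⟩
      refine ⟨(x + t • y : K), Subtype.mem _, fun h0 => ?_, ?_⟩
      · have := hy 1 t (by rw [one_smul]; exact Subtype.ext h0)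
        simp at this
      · simp only [Submodule.coe_add, Submodule.coe_smul, Pi.add_apply, Pi.smul_apply, smul_eq_mul]
        linear_combination ht
  obtain ⟨⟨i, j⟩, hij⟩ := Function.ne_iff.mp hv0
  have hij' : v (i, j) ≠ 0 := hij
  have hrank : ∀ k l, v (k, l) * v (i, j) = v (k, j) * v (i, l) := by
    intro k l
    fin_cases i <;> fin_cases j <;> fin_cases k <;> fin_cases l <;>
      simp only [Fin.zero_eta, Fin.mk_one] <;>
      first | ring1 | linear_combination hdet | linear_combination -hdet
  refine ⟨fun k => v (k, j) / v (i, j), fun l => v (i, l), fun h => ?_, fun h => ?_, ?_⟩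
  · have := congrFun h i
    simp [hij'] at this
  · exact hij' (congrFun h j)
  · convert hvK using 1
    ext ⟨k, l⟩
    rw [div_mul_eq_mul_div, div_eq_iff hij', hrank]

/-- Every nonzero qubit vector is rotated to a multiple of `|1⟩` by a unitary. -/
lemma exists_unitary_mulVec_eq {a : Fin 2 → ℂ} (ha : a ≠ 0) :
    ∃ U ∈ unitaryGroup (Fin 2) ℂ, ∃ c : ℂ, c ≠ 0 ∧ U *ᵥ a = c • Pi.single 1 1 := by
  set N : ℝ := Complex.normSq (a 0) + Complex.normSq (a 1) with hN
  have hN0 : 0 < N := by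
    have h0 := Complex.normSq_nonneg (a 0)
    have h1 := Complex.normSq_nonneg (a 1)
    refine lt_of_le_of_ne (add_nonneg h0 h1) fun h => ha ?_
    have e0 : a 0 = 0 := Complex.normSq_eq_zero.mp (by linarith)
    have e1 : a 1 = 0 := Complex.normSq_eq_zero.mp (by linarith)
    ext i
    fin_cases i <;> simp [e0, e1]
  set s : ℂ := (Real.sqrt N : ℂ) with hs
  have hss : s * s = a 0 * star (a 0) + a 1 * star (a 1) := by
    have h1 : s * s = (N : ℂ) := by
      rw [hs]
      exact_mod_cast Real.mul_self_sqrt hN0.le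
    rw [h1, hN, Complex.star_def, Complex.mul_conj, Complex.mul_conj]
    push_cast
    rfl
  have hs0 : s ≠ 0 := by
    rw [hs]
    exact_mod_cast (Real.sqrt_pos.mpr hN0).ne'
  have hstar : (starRingEnd ℂ) s = s := by simp [hs]
  -- The second row pairs a with itself and the first row annihilates it, so a goes to its norm s
  -- times |1⟩.
  refine ⟨!![-(a 1) / s, a 0 / s; star (a 0) / s, star (a 1) / s], ?_, s, hs0, ?_⟩
  · rw [mem_unitaryGroup_iff]
    simp only [Complex.star_def] at hss
    ext i j
    fin_cases i <;> fin_cases j <;>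
      simp [mul_apply, Fin.sum_univ_two, star_apply, hstar] <;> field_simp <;>
      first | ring1 | linear_combination -hss
  · simp only [Complex.star_def] at hss
    ext i
    fin_cases i
    · simp [mulVec, dotProduct, Fin.sum_univ_two]
      ring
    · simp [mulVec, dotProduct, Fin.sum_univ_two]
      field_simp
      linear_combination -hss

lemma kronecker_mulVec_product {m n : Type*} [Fintype m] [Fintype n] (U : Matrix m m ℂ)
    (V : Matrix n n ℂ) (a : m → ℂ) (b : n → ℂ) :
    (U ⊗ₖ V) *ᵥ (fun p => a p.1 * b p.2) = fun p => (U *ᵥ a) p.1 * (V *ᵥ b) p.2 := by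
  ext ⟨i, j⟩
  simp only [mulVec, dotProduct, Fintype.sum_prod_type, kronecker_apply, Finset.sum_mul_sum]
  exact Finset.sum_congr rfl fun _ _ => Finset.sum_congr rfl fun _ _ => by ring

lemma Matrix.rank_le_one_of_mulVec_eq_zero {γ : Matrix (Fin 2) (Fin 2) ℂ} {b : Fin 2 → ℂ}
    (hb : b ≠ 0) (h : γ *ᵥ b = 0) : γ.rank ≤ 1 := by
  have h1 := finrank_ker_mulVecLin γ
  have : Nontrivial (LinearMap.ker γ.mulVecLin) := ⟨⟨⟨b, h⟩, 0, fun h0 => hb (congrArg Subtype.val h0)⟩⟩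
  have h2 : 0 < Module.finrank ℂ (LinearMap.ker γ.mulVecLin) := Module.finrank_pos
  simp at h1
  omega

lemma Matrix.PosSemidef.mulVec_single_eq_zero {n : Type*} [Fintype n] [DecidableEq n]
    {M : Matrix n n ℂ} (hM : M.PosSemidef) {i : n} (hi : M i i = 0) :
    M *ᵥ Pi.single i 1 = 0 := by
  rw [← hM.dotProduct_mulVec_zero_iff]
  have : star (Pi.single i 1 : n → ℂ) = Pi.single i 1 := by
    ext k
    simp [Pi.single_apply, apply_ite]
  simp [this, hi]

lemma Matrix.PosSemidef.exists_ofReal_diag {n : Type*} [Fintype n]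
    {M : Matrix n n ℂ} (hM : M.PosSemidef) {i : n} (hi : M i i ≠ 0) :
    ∃ q : ℝ, 0 < q ∧ M i i = q := by
  have h0 : 0 ≤ M i i := hM.diag_nonneg
  have h1 : M i i = ((M i i).re : ℂ) := Complex.eq_re_of_ofReal_le h0
  refine ⟨(M i i).re, ?_, h1⟩
  have h2 : 0 < M i i := lt_of_le_of_ne h0 hi.symm
  rw [h1] at h2
  exact_mod_cast h2

lemma IsState.isPure_of_mulVec_eq_zero {γ : Matrix (Fin 2) (Fin 2) ℂ} (hγ : IsState γ)
    {b : Fin 2 → ℂ} (hb : b ≠ 0) (h : γ *ᵥ b = 0) : IsPure γ :=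
  hγ.isPure_of_rank_le_one (rank_le_one_of_mulVec_eq_zero hb h)

lemma IsState.traceLeft {m n : Type*} [Fintype m] [Fintype n] {β : Matrix (m × n) (m × n) ℂ}
    (hβ : IsState β) : IsState (traceLeft β) := ⟨hβ.1.traceLeft, by rw [trace_traceLeft, hβ.2]⟩

lemma IsState.traceRight {m n : Type*} [Fintype m] [Fintype n] {β : Matrix (m × n) (m × n) ℂ}
    (hβ : IsState β) : IsState (traceRight β) := ⟨hβ.1.traceRight, by rw [trace_traceRight, hβ.2]⟩

lemma traceLeft_mulVec_eq_zero {m n : Type*} [Fintype m] [Fintype n] [DecidableEq m]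
    {β : Matrix (m × n) (m × n) ℂ} {b : n → ℂ}
    (h : ∀ a : m → ℂ, β *ᵥ (fun p => a p.1 * b p.2) = 0) : traceLeft β *ᵥ b = 0 := by
  ext c
  simp only [mulVec, dotProduct, traceLeft_apply, Finset.sum_mul]
  rw [Finset.sum_comm]
  refine Finset.sum_eq_zero fun i _ => ?_
  have := congrFun (h (Pi.single i 1)) (i, c)
  simpa [mulVec, dotProduct, Fintype.sum_prod_type, Pi.single_apply] using this

lemma traceRight_mulVec_eq_zero {m n : Type*} [Fintype m] [Fintype n] [DecidableEq n]
    {β : Matrix (m × n) (m × n) ℂ} {a : m → ℂ}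
    (h : ∀ b : n → ℂ, β *ᵥ (fun p => a p.1 * b p.2) = 0) : traceRight β *ᵥ a = 0 := by
  ext c
  simp only [mulVec, dotProduct, traceRight_apply, Finset.sum_mul]
  rw [Finset.sum_comm]
  refine Finset.sum_eq_zero fun i _ => ?_
  have := congrFun (h (Pi.single i 1)) (c, i)
  simpa [mulVec, dotProduct, Fintype.sum_prod_type, Pi.single_apply] using this

/-- A space of vectors without components along `|01⟩` and `|10⟩` is annihilated by the Hermitian
operator `|01⟩⟨10| + |10⟩⟨01|`, whose partial traces vanish. -/
lemma exists_isHermitian_of_forall_mulVec (K : Submodule ℂ (Fin 2 × Fin 2 → ℂ))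
    (hK : ∀ w ∈ K, w (0, 1) = 0 ∧ w (1, 0) = 0) :
    ∃ Y : Matrix (Fin 2 × Fin 2) (Fin 2 × Fin 2) ℂ, Y.IsHermitian ∧ Y ≠ 0 ∧ traceLeft Y = 0 ∧
      traceRight Y = 0 ∧ ∀ w ∈ K, Y *ᵥ w = 0 := by
  refine ⟨single (0, 1) (1, 0) 1 + single (1, 0) (0, 1) 1, ?_, fun h => ?_, ?_, ?_, fun w hw => ?_⟩
  · rw [IsHermitian, conjTranspose_add, conjTranspose_single, conjTranspose_single, star_one,
      add_comm]
  · simpa using congrFun₂ h (0, 1) (1, 0)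
  · ext c d
    fin_cases c <;> fin_cases d <;> simp [traceLeft_apply]
  · ext c d
    fin_cases c <;> fin_cases d <;> simp [traceRight_apply]
  · obtain ⟨h1, h2⟩ := hK w hw
    ext p
    simp [add_mulVec, single_mulVec, h1, h2]

/-- A rank-two matrix annihilating `|00⟩` and `|11⟩` has no other kernel
vectors than their combinations. -/
lemma apply_eq_zero_of_mem_ker {β : Matrix (Fin 2 × Fin 2) (Fin 2 × Fin 2) ℂ} (hr : β.rank = 2)
    (h0 : β *ᵥ Pi.single (0, 0) 1 = 0) (h1 : β *ᵥ Pi.single (1, 1) 1 = 0)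
    {w : Fin 2 × Fin 2 → ℂ} (hw : β *ᵥ w = 0) : w (0, 1) = 0 ∧ w (1, 0) = 0 := by
  let f : Fin 2 → (Fin 2 × Fin 2 → ℂ) := fun i => Pi.single (i, i) 1
  have hli : LinearIndependent ℂ f :=
    (Pi.linearIndependent_single_one (Fin 2 × Fin 2) ℂ).comp (fun i : Fin 2 => (i, i))
      fun i j h => congrArg Prod.fst h
  have hle : Submodule.span ℂ (Set.range f) ≤ LinearMap.ker β.mulVecLin := by
    rw [Submodule.span_le]
    rintro _ ⟨i, rfl⟩
    fin_cases i
    · exact h0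
    · exact h1
  have hfr := finrank_span_eq_card hli
  have hk := finrank_ker_mulVecLin β
  have heq := Submodule.eq_of_le_of_finrank_eq hle (by simp at hfr hk; omega)
  have hmem : w ∈ Submodule.span ℂ (Set.range f) := by
    rw [heq]
    exact hw
  obtain ⟨c, rfl⟩ := (Submodule.mem_span_range_iff_exists_fun ℂ).mp hmem
  constructor <;> simp [f, Fin.sum_univ_two, Pi.single_apply]

/-- A rank-two two-qubit state without pure marginals either has the normal form `D ⊕ 0` with
positive diagonal entries in `D`, or has its kernel annihilated by a nonzero Hermitian operator
with vanishing partial traces. -/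
lemma exists_directSumZero_or_exists_isHermitian
    {β : Matrix (Fin 2 × Fin 2) (Fin 2 × Fin 2) ℂ} (hβ : IsState β) (hr : β.rank = 2)
    (hpl : ¬ IsPure (traceLeft β)) (hpr : ¬ IsPure (traceRight β)) :
    (∃ (q₁ q₂ q₃ : ℝ) (x y z : ℂ), 0 < q₁ ∧ 0 < q₂ ∧ 0 < q₃ ∧
      LUEquiv β (directSumZero
        !![(q₁ : ℂ), y, z; star y, (q₂ : ℂ), x; star z, star x, (q₃ : ℂ)])) ∨
    ∃ Y : Matrix (Fin 2 × Fin 2) (Fin 2 × Fin 2) ℂ, Y.IsHermitian ∧ Y ≠ 0 ∧ traceLeft Y = 0 ∧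
      traceRight Y = 0 ∧ ∀ v, β *ᵥ v = 0 → Y *ᵥ v = 0 := by
  have hk := finrank_ker_mulVecLin β
  obtain ⟨a, b, ha, hb, hab⟩ := exists_mem_product_of_one_lt_finrank
    (LinearMap.ker β.mulVecLin) (by simp [hr] at hk; omega)
  obtain ⟨U, hU, c, hc, hUa⟩ := exists_unitary_mulVec_eq ha
  obtain ⟨V, hV, d, hd, hVb⟩ := exists_unitary_mulVec_eq hb
  obtain ⟨hW, hW'⟩ := kronecker_mem_unitaryGroup' hU hV
  have hUU : U * Uᴴ = 1 := mem_unitaryGroup_iff.mp hU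
  have hVV : V * Vᴴ = 1 := mem_unitaryGroup_iff.mp hV
  set W := U ⊗ₖ V with hWdef
  have hWv : ∀ v, Wᴴ *ᵥ W *ᵥ v = v := fun v => by rw [mulVec_mulVec, hW, one_mulVec]
  set B := W * β * Wᴴ with hB
  have hBp : B.PosSemidef := hβ.1.mul_mul_conjTranspose_same W
  have hcol : B *ᵥ Pi.single (1, 1) 1 = 0 := by
    have h1 : (c * d) • (Pi.single (1, 1) 1 : Fin 2 × Fin 2 → ℂ)
        = W *ᵥ (fun p => a p.1 * b p.2) := by
      rw [hWdef, kronecker_mulVec_product, hUa, hVb]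
      ext ⟨i, j⟩
      fin_cases i <;> fin_cases j <;> simp
    have h2 : B *ᵥ ((c * d) • Pi.single (1, 1) 1) = 0 := by
      rw [h1, hB, mulVec_conj_eq_zero_iff hW, hWv]
      exact hab
    rw [mulVec_smul] at h2
    exact (smul_eq_zero.mp h2).resolve_left (mul_ne_zero hc hd)
  have hcol' : ∀ p, B p (1, 1) = 0 := fun p => by simpa using congrFun hcol p
  have hrow' : ∀ p, B (1, 1) p = 0 := fun p => by rw [← hBp.1.apply, hcol', star_zero]
  have hprod : ∀ x y : Fin 2 → ℂ, B *ᵥ (fun p => (U *ᵥ x) p.1 * (V *ᵥ y) p.2) = 0 →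
      β *ᵥ (fun p => x p.1 * y p.2) = 0 := by
    intro x y h
    rw [← kronecker_mulVec_product, ← hWdef, hB, mulVec_conj_eq_zero_iff hW, hWv] at h
    exact h
  have hne : ∀ {S : Matrix (Fin 2) (Fin 2) ℂ}, S * Sᴴ = 1 → Sᴴ *ᵥ Pi.single 1 1 ≠ 0 := by
    intro S hS h
    have h1 := congrArg (S *ᵥ ·) h
    simp only [mulVec_mulVec, hS, one_mulVec, mulVec_zero] at h1
    simpa using congrFun h1 1
  -- Otherwise B kills both |01⟩ and |11⟩, hence everything of the form u ⊗ |1⟩; the A₃ marginal is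
  -- then singular, so pure. The |10⟩ entry is symmetric.
  have h01 : B (0, 1) (0, 1) ≠ 0 := by
    intro h
    have h1 := hBp.mulVec_single_eq_zero h
    refine hpl (hβ.traceLeft.isPure_of_mulVec_eq_zero (hne hVV)
      (traceLeft_mulVec_eq_zero fun x => hprod _ _ ?_))
    have : (fun p : Fin 2 × Fin 2 => (U *ᵥ x) p.1 * (V *ᵥ Vᴴ *ᵥ Pi.single 1 1) p.2)
        = (U *ᵥ x) 0 • Pi.single (0, 1) 1 + (U *ᵥ x) 1 • Pi.single (1, 1) 1 := by
      rw [mulVec_mulVec, hVV, one_mulVec]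
      generalize U *ᵥ x = u
      ext ⟨i, j⟩
      fin_cases i <;> fin_cases j <;> simp
    rw [this, mulVec_add, mulVec_smul, mulVec_smul, h1, hcol, smul_zero, smul_zero, add_zero]
  have h10 : B (1, 0) (1, 0) ≠ 0 := by
    intro h
    have h1 := hBp.mulVec_single_eq_zero h
    refine hpr (hβ.traceRight.isPure_of_mulVec_eq_zero (hne hUU)
      (traceRight_mulVec_eq_zero fun y => hprod _ _ ?_))
    have : (fun p : Fin 2 × Fin 2 => (U *ᵥ Uᴴ *ᵥ Pi.single 1 1) p.1 * (V *ᵥ y) p.2)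
        = (V *ᵥ y) 0 • Pi.single (1, 0) 1 + (V *ᵥ y) 1 • Pi.single (1, 1) 1 := by
      rw [mulVec_mulVec, hUU, one_mulVec]
      generalize V *ᵥ y = u
      ext ⟨i, j⟩
      fin_cases i <;> fin_cases j <;> simp
    rw [this, mulVec_add, mulVec_smul, mulVec_smul, h1, hcol, smul_zero, smul_zero, add_zero]
  by_cases h00 : B (0, 0) (0, 0) = 0
  · right
    have hBr : B.rank = 2 := by
      have hdW : IsUnit W.det := (isUnit_iff_isUnit_det W).mp ⟨⟨W, Wᴴ, hW', hW⟩, rfl⟩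
      have hdW' : IsUnit Wᴴ.det := (isUnit_iff_isUnit_det Wᴴ).mp ⟨⟨Wᴴ, W, hW, hW'⟩, rfl⟩
      rw [hB, rank_mul_eq_left_of_isUnit_det _ _ hdW', rank_mul_eq_right_of_isUnit_det _ _ hdW, hr]
    obtain ⟨E, hE, hE0, hEl, hEr, hEk⟩ :=
      exists_isHermitian_of_forall_mulVec (LinearMap.ker B.mulVecLin) fun w hw =>
        apply_eq_zero_of_mem_ker hBr (hBp.mulVec_single_eq_zero h00) hcol hw
    have hWc : Wᴴ = Uᴴ ⊗ₖ Vᴴ := conjTranspose_kronecker U V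
    have hU' : Uᴴ ∈ unitaryGroup (Fin 2) ℂ := Unitary.star_mem hU
    have hV' : Vᴴ ∈ unitaryGroup (Fin 2) ℂ := Unitary.star_mem hV
    -- The flip operator found for B is rotated back to β by the inverse product unitary.
    refine ⟨Wᴴ * E * Wᴴᴴ, isHermitian_mul_mul_conjTranspose _ hE, fun h => hE0 ?_, ?_, ?_, ?_⟩
    · calc E = (W * Wᴴ) * E * (W * Wᴴ) := by rw [hW', one_mul, mul_one]
        _ = W * (Wᴴ * E * Wᴴᴴ) * Wᴴ := by simp only [mul_assoc, conjTranspose_conjTranspose]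
        _ = 0 := by rw [h, mul_zero, zero_mul]
    · rw [hWc]
      exact traceLeft_kronecker_conj_eq_zero hEl hU' _
    · rw [hWc]
      exact traceRight_kronecker_conj_eq_zero hEr _ hV'
    · intro v hv
      rw [mulVec_conj_eq_zero_iff (by rwa [conjTranspose_conjTranspose]),
        conjTranspose_conjTranspose]
      refine hEk _ ?_
      change B *ᵥ (W *ᵥ v) = 0
      rw [hB, mulVec_conj_eq_zero_iff hW, hWv, hv]
  · left
    obtain ⟨q₁, hq₁, h1⟩ := hBp.exists_ofReal_diag h00
    obtain ⟨q₂, hq₂, h2⟩ := hBp.exists_ofReal_diag h01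
    obtain ⟨q₃, hq₃, h3⟩ := hBp.exists_ofReal_diag h10
    refine ⟨q₁, q₂, q₃, B (0, 1) (1, 0), B (0, 0) (0, 1), B (0, 0) (1, 0), hq₁, hq₂, hq₃,
      U, hU, V, hV, ?_⟩
    rw [hBp.1.apply, hBp.1.apply, hBp.1.apply, directSumZero_eq_of]
    change _ = B
    ext ⟨i, j⟩ ⟨k, l⟩
    fin_cases i <;> fin_cases j <;> fin_cases k <;> fin_cases l <;> simp [hcol', hrow', h1, h2, h3]

/-! ### The characterisation. -/

theorem mainTheorem1 (ρ₁ : Matrix (Fin 2) (Fin 2) ℂ)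
    (ρ₂₃ : Matrix (Fin 2 × Fin 2) (Fin 2 × Fin 2) ℂ)
    (h₁ : IsState ρ₁) (h₂₃ : IsState ρ₂₃) :
    IsUDA 2 (tensor₁₂ ρ₁ ρ₂₃) ↔
      (∃ i : Fin 3, IsPure (marginal {i} (tensor₁₂ ρ₁ ρ₂₃))) ∨
      IsPure ρ₂₃ ∨
      (ρ₁.rank = 2 ∧ ρ₂₃.rank = 2 ∧
        ∃ (q₁ q₂ q₃ : ℝ) (x y z : ℂ), 0 < q₁ ∧ 0 < q₂ ∧ 0 < q₃ ∧
          LUEquiv ρ₂₃ (directSumZero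
            !![(q₁ : ℂ), y, z; star y, (q₂ : ℂ), x; star z, star x, (q₃ : ℂ)])) := by
  rw [exists_isPure_marginal_tensor₁₂_iff h₁.2 h₂₃.2]
  constructor
  · intro h
    by_contra! hn
    obtain ⟨⟨hα, hr, hl⟩, hβ, hn⟩ := hn
    have hdet : ρ₁.det ≠ 0 := by
      intro h0
      obtain ⟨v, hv, hv0⟩ := exists_mulVec_eq_zero_iff.mpr h0
      exact hα (h₁.isPure_of_mulVec_eq_zero hv hv0)
    have hrank₁ : ρ₁.rank = 2 := by simpa using rank_of_det_ne_zero hdet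
    have hrank : 1 < ρ₂₃.rank := not_le.mp fun h => hβ (h₂₃.isPure_of_rank_le_one h)
    obtain ⟨Y, hY, hY0, hYl, hYr, hYk⟩ : ∃ Y : Matrix (Fin 2 × Fin 2) (Fin 2 × Fin 2) ℂ,
        Y.IsHermitian ∧ Y ≠ 0 ∧ traceLeft Y = 0 ∧ traceRight Y = 0 ∧
        ∀ v, ρ₂₃ *ᵥ v = 0 → Y *ᵥ v = 0 := by
      by_cases hr2 : ρ₂₃.rank = 2
      · refine (exists_directSumZero_or_exists_isHermitian h₂₃ hr2 hl hr).resolve_left ?_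
        rintro ⟨q₁, q₂, q₃, x, y, z, h1, h2, h3, hLU⟩
        exact hn hrank₁ hr2 q₁ q₂ q₃ x y z h1 h2 h3 hLU
      -- Here the rank is at least 3, so the kernel consists of multiples of one vector and the
      -- dimension count applies.
      · have hk := finrank_ker_mulVecLin ρ₂₃
        have hk1 : Module.finrank ℂ (LinearMap.ker ρ₂₃.mulVecLin) ≤ 1 := by
          simp at hk
          omega
        obtain ⟨v, hv⟩ := finrank_le_one_iff.mp hk1
        obtain ⟨Y, hY, hY0, hYl, hYr, hYv⟩ := exists_isHermitian_mulVec_eq_zero v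
        refine ⟨Y, hY, hY0, hYl, hYr, fun w hw => ?_⟩
        obtain ⟨c, hc⟩ := hv ⟨w, hw⟩
        have hcw : c • (v : Fin 2 × Fin 2 → ℂ) = w := congrArg Subtype.val hc
        rw [← hcw, mulVec_smul, hYv, smul_zero]
    exact not_isUDA_tensor₁₂ h₁ h₂₃ hdet hY hY0 hYl hYr hYk h
  · rintro ((hα | hr | hl) | hβ | ⟨-, hr, q₁, q₂, q₃, x, y, z, hq₁, -, -, hLU⟩)
    · exact isUDA_tensor₁₂_of_isPure_left h₁ h₂₃ hα
    · exact isUDA_tensor₁₂_of_isPure_traceRight h₁ h₂₃ hr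
    · exact isUDA_tensor₁₂_of_isPure_traceLeft h₁ h₂₃ hl
    · exact isUDA_tensor₁₂_of_isPure_right h₁ h₂₃ hβ
    · exact isUDA_tensor₁₂_of_lUEquiv_directSumZero h₁ h₂₃ hr (by simpa using hq₁.ne') hLU
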